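/- **Setting.** Let $(V,d)$ be a finite nonempty metric space with $n=|V|$, and let $k\ge 1$. For $P\subseteq V$ and $B\subseteq P$ write $\mathrm{rad}(P,B)=\max_{x\in P}\min_{c\in B}d(x,c)$, and let $\mathrm{OPT}_k(P)$ be the minimum of $\mathrm{rad}(P,B)$ over all $B\subseteq P$ with $|B|\le k$. A set $B\subseteq P$ with $|B|\le k$ is a *$\rho$-approximation* for $P$ if $\mathrm{rad}(P,B)\le\rho\,\mathrm{OPT}_k(P)$; an *$\alpha$-approximation algorithm* for $k$-center returns an $\alpha$-approximation $A(P)$ for every instance $P\subseteq V$. **Sampling procedure** with parameters $\varepsilon>0$ and $\varphi>0$ ($\log$ is the natural logarithm; probabilities are truncated at $1$; $d(x,S)=\min_{s\in S}d(x,s)$). Start with $S=\emptyset$, $R=V$. While $|R|>\frac{4}{\varepsilon}kn^{\varepsilon}\log n$: 1. Draw random subsets $T$ and $H$ of $R$, where each point of $R$ is put into $T$ with probability $9kn^{\varepsilon}(\log n)/|R|$ and into $H$ with probability $4n^{\varepsilon}(\log n)/|R|$, all choices being independent; replace $S$ by $S\cup T$. 2. Let $v$ be the point in position $\lceil\varphi\log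 n\rceil$ when the points of $H$ are ordered by their distance to $S$ from farthest to nearest. 3. Remove from $R$ all points of $S$ and all points $x$ with $d(x,S)\le d(v,S)$ (only the points of $S$ if $H$ has fewer than $\lceil\varphi\log n\rceil$ points). When the loop stops, return $C=S\cup R$. **Statement.** For all $\varepsilon>0$ and $\varphi>0$ there is a constant $K$, depending only on $\varepsilon$ and $\varphi$, such that the following holds. Let $\gamma>0$ and $x=1+\gamma$, and suppose that for some $0<b\le 5$ $$\frac{\varphi+x+\sqrt{2x\varphi+x^2}}{b}\;\le\;\varphi+\frac x2-\sqrt{2x\varphi+\frac{x^2}{4}} .$$ Then for every finite nonempty metric space $V$ with $n$ points, every $k\ge 1$, every $\alpha\ge 1$ and every $\alpha$-approximation algorithm $A$ for $k$-center, with probability at least $1-K\,n^{-(1+\gamma)}$ the sampling procedure terminates and the set $A(C)$ obtained by running $A$ on the returned sample $C$ is a $(4\alpha+2)$-approximation for the $k$-center problem on $V$. In particular, for $\alpha=2$ the result is a $10$-approximation with at least this probability. -/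

import Mathlib

open scoped NNReal ENNReal

/-! ## The k-center problem on a finite metric space -/

section KCenter

variable {V : Type*} [MetricSpace V]

/-- The covering radius `max_{x ∈ P} min_{c ∈ B} d(x, c)` of the centers `B` for the points `P`.
It is `∞` if `P` is nonempty and `B` is empty. -/
noncomputable def coveringRadius (P B : Finset V) : ℝ≥0∞ :=
  ⨆ x ∈ P, Metric.infEDist x (B : Set V)

/-- The optimal `k`-center value of the instance `P`: the least covering radius of a set of at
most `k` centers chosen among the points of `P`. -/
noncomputable def kCenterOpt (k : ℕ) (P : Finset V) : ℝ≥0∞ :=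
  ⨅ B : Finset V, ⨅ _ : B ⊆ P, ⨅ _ : B.card ≤ k, coveringRadius P B

/-- `B` is a feasible `k`-center solution of the instance `P`, of value at most `r` times the
optimum. -/
def IsApproxSolution (k : ℕ) (r : ℝ) (P B : Finset V) : Prop :=
  B ⊆ P ∧ B.card ≤ k ∧ coveringRadius P B ≤ ENNReal.ofReal r * kCenterOpt k P

/-- `A` is an `r`-approximation algorithm for `k`-center: on every instance made of points of `V`
it returns an `r`-approximate solution of that instance. -/
def IsApproxAlgorithm (k : ℕ) (r : ℝ) (A : Finset V → Finset V) : Prop :=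
  ∀ P : Finset V, IsApproxSolution k r P (A P)

end KCenter

/-! ## The sampling procedure -/

section Sampling

/-- A real number clipped to `[0, 1]`, to be used as a probability. -/
noncomputable def clipProb (r : ℝ) : ℝ≥0 := min 1 r.toNNReal

theorem clipProb_le_one (r : ℝ) : clipProb r ≤ 1 := min_le_left _ _

theorem sum_subset_weights {V : Type*} (R : Finset V) (r : ℝ) :
    ∑ T ∈ R.powerset, ((clipProb r ^ T.card * (1 - clipProb r) ^ (R.card - T.card) : ℝ≥0) : ℝ≥0∞)
      = 1 := by
  rw [← ENNReal.ofNNReal_finsetSum, Finset.sum_pow_mul_eq_add_pow,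
    add_tsub_cancel_of_le (clipProb_le_one r)]
  simp

open Classical in
/-- The random subset of `R` that contains each point of `R` independently with probability `r`
(clipped to `[0, 1]`). -/
noncomputable def randomSubset {V : Type*} (R : Finset V) (r : ℝ) : PMF (Finset V) :=
  PMF.ofFinset
    (fun T => if T ⊆ R then
      ((clipProb r ^ T.card * (1 - clipProb r) ^ (R.card - T.card) : ℝ≥0) : ℝ≥0∞) else 0)
    R.powerset
    (by
      rw [← sum_subset_weights R r]
      exact Finset.sum_congr rfl fun T hT => if_pos (Finset.mem_powerset.mp hT))
    (fun T hT => if_neg fun h => hT (Finset.mem_powerset.mpr h))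

variable {V : Type*} [MetricSpace V]

open Classical in
/-- `v` is the point in position `t` when the points of `H` are ordered by their distance to `S`
from farthest to nearest (ties may be broken in any way; they do not change `d(v, S)`). Here `d(x, S)` is the least
distance from `x` to a point of `S`, and `∞` if `S` is empty. -/
def IsPivot (t : ℕ) (H S : Finset V) (v : V) : Prop :=
  v ∈ H ∧ (H.filter fun h => Metric.infEDist v (S : Set V) < Metric.infEDist h (S : Set V)).card < t ∧
    t ≤ (H.filter fun h => Metric.infEDist v (S : Set V) ≤ Metric.infEDist h (S : Set V)).card

open Classical in
/-- The points that stay in `R`: sampled points are always removed, and so is every point that is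
at most as far from the sample `S` as the selected pivot `v`. If `H` has fewer than `t` points,
there is no pivot, and only sampled points are removed. -/
noncomputable def survivors (t : ℕ) (H S R : Finset V) : Finset V :=
  R.filter fun x => x ∉ S ∧ ∀ v, IsPivot t H S v → ¬ Metric.infEDist x (S : Set V) ≤ Metric.infEDist v (S : Set V)

variable [Fintype V]

/-- The while-loop runs as long as `|R| > (4/ε) k n^ε log n`, where `n = |V|`. -/
def LoopActive (V : Type*) [Fintype V] (k : ℕ) (ε : ℝ) (R : Finset V) : Prop :=
  4 / ε * k * (Fintype.card V : ℝ) ^ ε * Real.log (Fintype.card V) < R.card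

open Classical in
/-- One evaluation of the while-loop on the state `(S, R)`. If the loop condition holds, then `S`
grows by a random subset of `R` of rate `9 k n^ε log n / |R|`, an independent random subset `H` of
`R` of rate `4 n^ε log n / |R|` is drawn, and the points of `R` that are represented at least as
well as the point of `H` in position `φ log n` (rounded up) are removed. Otherwise the state does
not change. -/
noncomputable def eimStep (k : ℕ) (ε φ : ℝ) (s : Finset V × Finset V) :
    PMF (Finset V × Finset V) :=
  if LoopActive V k ε s.2 then
    (randomSubset s.2
        (9 * k * (Fintype.card V : ℝ) ^ ε * Real.log (Fintype.card V) / s.2.card)).bind fun T =>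
      (randomSubset s.2
          (4 * (Fintype.card V : ℝ) ^ ε * Real.log (Fintype.card V) / s.2.card)).bind fun H =>
        PMF.pure (s.1 ∪ T,
          survivors ⌈φ * Real.log (Fintype.card V)⌉₊ H (s.1 ∪ T) s.2)
  else PMF.pure s

/-- The law of the state `(S, R)` after `N` evaluations of the loop, started at `(∅, V)`. -/
noncomputable def eimState (k : ℕ) (ε φ : ℝ) : ℕ → PMF (Finset V × Finset V)
  | 0 => PMF.pure (∅, Finset.univ)
  | N + 1 => (eimState k ε φ N).bind (eimStep k ε φ)

open Classical in
/-- The probability that the sampling procedure terminates and returns a set `C = S ∪ R` in the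
event `E`. States in which the loop has stopped do not change any more, so that the supremum over
`N` is the limit of an increasing sequence of probabilities; runs that never stop count as
failures. -/
noncomputable def eimSampleProb (k : ℕ) (ε φ : ℝ) (E : Set (Finset V)) : ℝ≥0∞ :=
  ⨆ N : ℕ, (eimState k ε φ N).toOuterMeasure
    {s : Finset V × Finset V | ¬ LoopActive V k ε s.2 ∧ s.1 ∪ s.2 ∈ E}

end Sampling

/-! ## Probability estimates -/

/-! Write `n = |V|`, `L = log n`, `M = n ^ (ε / 4)`, and let `ρ` be the optimum on `V`. The `k`
optimal balls of radius `ρ` cut `R` into pieces. In one round, with high probability `T` meets every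
large piece, so few points of `R` stay farther than `2 * ρ` from `S` (`card_far_le`). Fewer than `φ
* L` of these enter `H`, so the pivot, if any, is within `2 * ρ` and only covered points are
dropped. At the same time at least `φ * L` points of `H` lie among the farthest `|R| / M ^ 2` points
of `R`, which forces all survivors to be among them, so `R` shrinks by a factor `M`.

Each round fails with probability at most `3 * n ^ (-x)` (`eimStep_failure_le` and `k ≤ n`). A union
bound over `⌈4 / ε⌉` rounds ends the loop with a sample `C` that covers `V` within `2 * ρ`. The
optimum of `C` is at most `2 * ρ`, so the triangle inequality bounds the radius of `A C` by `(2 * α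
+ 2) * ρ`, which is stronger than required. -/

theorem PMF.toOuterMeasure_bind_le {α β : Type*} (p : PMF α) (f : α → PMF β) (A : Set α)
    (B : Set β) (δ : ℝ≥0∞) (h : ∀ a ∉ A, (f a).toOuterMeasure B ≤ δ) :
    (p.bind f).toOuterMeasure B ≤ p.toOuterMeasure A + δ := by
  classical
  rw [PMF.toOuterMeasure_bind_apply, PMF.toOuterMeasure_apply]
  calc ∑' a, p a * (f a).toOuterMeasure B
      ≤ ∑' a, (A.indicator p a + p a * δ) := by
        refine ENNReal.tsum_le_tsum fun a => ?_
        by_cases ha : a ∈ A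
        · rw [Set.indicator_of_mem ha]
          refine le_add_right ?_
          calc p a * (f a).toOuterMeasure B ≤ p a * 1 := by
                gcongr
                calc (f a).toOuterMeasure B ≤ (f a).toOuterMeasure Set.univ :=
                      MeasureTheory.measure_mono (Set.subset_univ _)
                  _ = 1 := (PMF.toOuterMeasure_apply_eq_one_iff _ _).2 (Set.subset_univ _)
            _ = p a := mul_one _
        · rw [Set.indicator_of_notMem ha, zero_add]
          gcongr
          exact h a ha
    _ = _ := by rw [ENNReal.tsum_add, ENNReal.tsum_mul_right, PMF.tsum_coe, one_mul]

theorem PMF.one_sub_le_toOuterMeasure {α : Type*} (p : PMF α) (A : Set α) :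
    1 - p.toOuterMeasure Aᶜ ≤ p.toOuterMeasure A := by
  rw [tsub_le_iff_right,
    ← (PMF.toOuterMeasure_apply_eq_one_iff p Set.univ).2 (Set.subset_univ _),
    ← Set.union_compl_self A]
  exact MeasureTheory.measure_union_le _ _

theorem coe_clipProb (r : ℝ) : (clipProb r : ℝ) = min 1 (max r 0) := by
  simp [clipProb]

open Classical in
-- The weights factor over the points of `R`: a point of `D` contributes `1 - p + p * a`, any other
-- point `1`.
theorem sum_subset_mgf {V : Type*} (R D : Finset V) (hD : D ⊆ R) (p a : ℝ) :
    ∑ T ∈ R.powerset, p ^ T.card * (1 - p) ^ (R.card - T.card) * a ^ (T ∩ D).card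
      = (1 - p + p * a) ^ D.card := by
  have h := Finset.prod_add (fun i => p * if i ∈ D then a else 1) (fun _ => 1 - p) R
  have hl : ∏ i ∈ R, ((p * if i ∈ D then a else 1) + (1 - p)) = (1 - p + p * a) ^ D.card := by
    rw [← Finset.prod_subset hD]
    · rw [Finset.prod_congr rfl (g := fun _ => 1 - p + p * a), Finset.prod_const]
      intro i hi
      rw [if_pos hi]; ring
    · intro i _ hi
      rw [if_neg hi]; ring
  rw [← hl, h]
  refine Finset.sum_congr rfl fun T hT => ?_
  rw [Finset.prod_mul_distrib, Finset.prod_const, Finset.prod_const,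
    Finset.card_sdiff_of_subset (Finset.mem_powerset.1 hT), Finset.prod_ite_mem,
    Finset.prod_const]
  ring

open Classical in
/-- Markov's inequality for the variable `y * a ^ |T ∩ D|` of a random subset `T`. -/
theorem randomSubset_toOuterMeasure_le {V : Type*} (R D : Finset V) (hD : D ⊆ R) (r y a : ℝ)
    (hy : 0 ≤ y) (ha : 0 ≤ a) (E : Set (Finset V))
    (hE : ∀ T ∈ E, T ⊆ R → 1 ≤ y * a ^ (T ∩ D).card) :
    (randomSubset R r).toOuterMeasure E
      ≤ ENNReal.ofReal (y * (1 - clipProb r + clipProb r * a) ^ D.card) := by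
  have hp1 : (clipProb r : ℝ) ≤ 1 := clipProb_le_one r
  have hp0 : (0 : ℝ) ≤ clipProb r := (clipProb r).2
  rw [← sum_subset_mgf R D hD, Finset.mul_sum, ENNReal.ofReal_sum_of_nonneg, PMF.toOuterMeasure_apply,
    tsum_eq_sum (s := R.powerset)]
  · refine Finset.sum_le_sum fun T hT => ?_
    have hT' := Finset.mem_powerset.1 hT
    by_cases hTE : T ∈ E
    · rw [Set.indicator_of_mem hTE]
      have : randomSubset R r T = ENNReal.ofReal
          ((clipProb r : ℝ) ^ T.card * (1 - clipProb r) ^ (R.card - T.card)) := by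
        rw [randomSubset, PMF.ofFinset_apply, if_pos hT', ENNReal.ofReal]
        congr 1
        apply NNReal.coe_injective
        rw [Real.coe_toNNReal _ (by have := sub_nonneg.2 hp1; positivity)]
        push_cast [NNReal.coe_sub (clipProb_le_one r)]
        rfl
      rw [this]
      apply ENNReal.ofReal_le_ofReal
      have h0 : 0 ≤ (clipProb r : ℝ) ^ T.card * (1 - clipProb r) ^ (R.card - T.card) := by
        have := sub_nonneg.2 hp1
        positivity
      nlinarith [hE T hTE hT', mul_le_mul_of_nonneg_left (hE T hTE hT') h0]
    · rw [Set.indicator_of_notMem hTE]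
      exact zero_le
  · intro T hT
    rw [Set.indicator_apply_eq_zero]
    intro _
    rw [randomSubset, PMF.ofFinset_apply, if_neg fun h => hT (Finset.mem_powerset.2 h)]
  · intro T _
    have := sub_nonneg.2 hp1
    positivity

open Classical in
theorem randomSubset_miss_le {V : Type*} (R D : Finset V) (hD : D ⊆ R) (r c : ℝ) (hc : 0 < c)
    (h : c ≤ r * D.card) :
    (randomSubset R r).toOuterMeasure {T | Disjoint T D} ≤ ENNReal.ofReal (Real.exp (-c)) := by
  -- With `a = 0` the Markov variable is the indicator of missing `D`, because `0 ^ 0 = 1`.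
  refine (randomSubset_toOuterMeasure_le R D hD r 1 0 zero_le_one le_rfl _ ?_).trans
    (ENNReal.ofReal_le_ofReal ?_)
  · intro T hT _
    rw [Set.mem_ofPred_eq, Finset.disjoint_iff_inter_eq_empty] at hT
    simp [hT]
  have hcard : D.card ≠ 0 := by
    rintro h0
    rw [h0] at h
    simp only [Nat.cast_zero, mul_zero] at h
    linarith
  have hr : 0 < r := by
    by_contra! hr
    have : r * D.card ≤ 0 := mul_nonpos_of_nonpos_of_nonneg hr (Nat.cast_nonneg _)
    linarith
  rw [one_mul, mul_zero, add_zero, coe_clipProb, max_eq_left hr.le]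
  rcases le_total 1 r with h1 | h1
  · rw [min_eq_left h1, sub_self, zero_pow hcard]
    positivity
  · rw [min_eq_right h1]
    calc (1 - r) ^ D.card ≤ Real.exp (-r) ^ D.card := by
          refine pow_le_pow_left₀ (by linarith) ?_ _
          linarith [Real.add_one_le_exp (-r)]
      _ = Real.exp (-(r * D.card)) := by rw [← Real.exp_nat_mul]; congr 1; ring
      _ ≤ _ := by gcongr

open Classical in
-- Chernoff bound with `a = e`; the constant comes from `e - 1 < 1.72`. The null event that `T` is
-- not contained in `R` is included so that good samples carry this fact.
theorem randomSubset_upper_tail_le {V : Type*} (R D : Finset V) (hD : D ⊆ R) (r c μ : ℝ)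
    (hr : 0 ≤ r) (h : r * D.card ≤ μ) :
    (randomSubset R r).toOuterMeasure {T | ¬ (T ⊆ R ∧ (T ∩ D).card < ⌈c⌉₊)}
      ≤ ENNReal.ofReal (Real.exp (-c + 1.72 * μ)) := by
  refine (randomSubset_toOuterMeasure_le R D hD r (Real.exp (-c)) (Real.exp 1)
    (Real.exp_pos _).le (Real.exp_pos _).le _ ?_).trans (ENNReal.ofReal_le_ofReal ?_)
  · intro T hT hTR
    have hT : ⌈c⌉₊ ≤ (T ∩ D).card := by
      by_contra! h'
      exact hT ⟨hTR, h'⟩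
    rw [← Real.exp_nat_mul, ← Real.exp_add, Real.one_le_exp_iff]
    linarith [Nat.ceil_le.1 hT]
  have hp : (clipProb r : ℝ) ≤ r := by
    rw [coe_clipProb, max_eq_left hr]; exact min_le_right _ _
  have hp0 : (0 : ℝ) ≤ clipProb r := (clipProb r).2
  have he := Real.exp_one_lt_d9
  have he' := Real.exp_pos 1
  have hp1 : (clipProb r : ℝ) ≤ 1 := clipProb_le_one r
  rw [Real.exp_add]
  gcongr
  calc (1 - clipProb r + clipProb r * Real.exp 1) ^ D.card
      ≤ Real.exp (1.72 * r) ^ D.card := by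
        refine pow_le_pow_left₀ ?_ ?_ _
        · have := sub_nonneg.2 hp1
          positivity
        · nlinarith [Real.add_one_le_exp (1.72 * r)]
    _ = Real.exp (1.72 * (r * D.card)) := by rw [← Real.exp_nat_mul]; congr 1; ring
    _ ≤ _ := by gcongr

open Classical in
-- Chernoff bound with `a = 1 / e`, using `1 - 1 / e > 1 / 2`. The hypothesis `h'` serves the case
-- where the rate is clipped to `1`.
theorem randomSubset_lower_tail_le {V : Type*} (R D : Finset V) (hD : D ⊆ R) (r c μ : ℝ)
    (h : μ ≤ r * D.card) (h' : μ ≤ D.card) :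
    (randomSubset R r).toOuterMeasure {T | (T ∩ D).card < ⌈c⌉₊}
      ≤ ENNReal.ofReal (Real.exp (c - μ / 2)) := by
  refine (randomSubset_toOuterMeasure_le R D hD r (Real.exp c) (Real.exp (-1))
    (Real.exp_pos _).le (Real.exp_pos _).le _ ?_).trans (ENNReal.ofReal_le_ofReal ?_)
  · intro T hT hTR
    rw [← Real.exp_nat_mul, ← Real.exp_add, Real.one_le_exp_iff]
    have := Nat.lt_ceil.1 hT
    linarith
  have hp0 : (0 : ℝ) ≤ clipProb r := (clipProb r).2
  have hp1 : (clipProb r : ℝ) ≤ 1 := clipProb_le_one r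
  have hμ : μ ≤ clipProb r * D.card := by
    rw [coe_clipProb]
    rcases le_total 1 (max r 0) with h1 | h1
    · rwa [min_eq_left h1, one_mul]
    · rw [min_eq_right h1]
      exact h.trans (by gcongr; exact le_max_left _ _)
  have he : Real.exp (-1) < 1 / 2 := by
    have := Real.exp_neg_one_lt_d9
    linarith
  have he' := Real.exp_pos (-1)
  rw [sub_eq_add_neg c, Real.exp_add]
  gcongr
  calc (1 - clipProb r + clipProb r * Real.exp (-1)) ^ D.card
      ≤ Real.exp (-(clipProb r / 2)) ^ D.card := by
        refine pow_le_pow_left₀ ?_ ?_ _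
        · have := sub_nonneg.2 hp1
          positivity
        · nlinarith [Real.add_one_le_exp (-((clipProb r : ℝ) / 2))]
    _ = Real.exp (-(clipProb r * D.card / 2)) := by rw [← Real.exp_nat_mul]; congr 1; ring
    _ ≤ _ := by gcongr

/-! ## Covering and pivots -/

section Covering

variable {V : Type*} [MetricSpace V]

theorem infEDist_le_coveringRadius {P B : Finset V} {x : V} (hx : x ∈ P) :
    Metric.infEDist x (B : Set V) ≤ coveringRadius P B :=
  le_iSup₂ (f := fun x (_ : x ∈ P) => Metric.infEDist x (B : Set V)) x hx

theorem coveringRadius_le_iff {P B : Finset V} {r : ℝ≥0∞} :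
    coveringRadius P B ≤ r ↔ ∀ x ∈ P, Metric.infEDist x (B : Set V) ≤ r :=
  iSup₂_le_iff

theorem Finset.exists_edist_eq_infEDist {B : Finset V} (hB : B.Nonempty) (x : V) :
    ∃ c ∈ B, edist x c = Metric.infEDist x (B : Set V) := by
  obtain ⟨c, hc, h⟩ := B.finite_toSet.isCompact.exists_infEDist_eq_edist (by simpa using hB) x
  exact ⟨c, hc, h.symm⟩

theorem exists_kCenter_optimal {P : Finset V} (hP : P.Nonempty) {k : ℕ} (hk : 1 ≤ k) :
    kCenterOpt k P ≠ ∞ ∧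
      ∃ B ⊆ P, B.card ≤ k ∧ ∀ x ∈ P, ∃ c ∈ B, edist x c ≤ kCenterOpt k P := by
  classical
  obtain ⟨p, hp⟩ := hP
  have hne : (P.powerset.filter fun B => B.card ≤ k).Nonempty :=
    ⟨{p}, by simp [hp, hk]⟩
  have hlt : kCenterOpt k P < ∞ := by
    refine lt_of_le_of_lt (iInf_le_of_le {p} <| iInf_le_of_le (by simpa) <|
      iInf_le_of_le (by simpa) le_rfl) ?_
    have : coveringRadius P {p} ≤ ∑ x ∈ P, edist x p := by
      refine coveringRadius_le_iff.2 fun x hx => ?_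
      simpa using Finset.single_le_sum (f := fun x => edist x p) (fun _ _ => zero_le) hx
    exact this.trans_lt (ENNReal.sum_lt_top.2 fun x _ => edist_lt_top x p)
  obtain ⟨B, hB, hmin⟩ := Finset.exists_min_image _ (coveringRadius P) hne
  rw [Finset.mem_filter, Finset.mem_powerset] at hB
  have hle : coveringRadius P B ≤ kCenterOpt k P :=
    le_iInf fun B' => le_iInf fun h1 => le_iInf fun h2 =>
      hmin B' (Finset.mem_filter.2 ⟨Finset.mem_powerset.2 h1, h2⟩)
  have hBne : B.Nonempty := by
    rw [Finset.nonempty_iff_ne_empty]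
    rintro rfl
    have := (infEDist_le_coveringRadius hp).trans_lt (hle.trans_lt hlt)
    simp at this
  refine ⟨hlt.ne, B, hB.1, hB.2, fun x hx => ?_⟩
  obtain ⟨c, hc, hxc⟩ := Finset.exists_edist_eq_infEDist hBne x
  exact ⟨c, hc, hxc ▸ (infEDist_le_coveringRadius hx).trans hle⟩

/-- Centers must belong to `C`, so each optimal center of `P` whose ball meets `C` is moved to a
point of `C` in that ball. This costs one more radius. -/
theorem kCenterOpt_le_two_mul {P C : Finset V} (hC : C ⊆ P) (hP : P.Nonempty) {k : ℕ}
    (hk : 1 ≤ k) : kCenterOpt k C ≤ 2 * kCenterOpt k P := by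
  classical
  obtain ⟨-, B, -, hBk, hB⟩ := exists_kCenter_optimal hP hk
  let near : V → Prop := fun b => ∃ c ∈ C, edist c b ≤ kCenterOpt k P
  let f : V → V := fun b => if h : near b then h.choose else b
  have hf : ∀ b, near b → f b ∈ C ∧ edist (f b) b ≤ kCenterOpt k P := by
    intro b hb
    simp only [f, dif_pos hb]
    exact hb.choose_spec
  refine iInf_le_of_le ((B.filter near).image f) <| iInf_le_of_le ?_ <| iInf_le_of_le ?_ ?_
  · intro y hy
    obtain ⟨b, hb, rfl⟩ := Finset.mem_image.1 hy
    exact (hf b (Finset.mem_filter.1 hb).2).1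
  · exact (Finset.card_image_le.trans (Finset.card_filter_le _ _)).trans hBk
  · refine coveringRadius_le_iff.2 fun x hx => ?_
    obtain ⟨b, hb, hxb⟩ := hB x (hC hx)
    have hnb : near b := ⟨x, hx, hxb⟩
    have hmem : f b ∈ (((B.filter near).image f : Finset V) : Set V) :=
      Finset.mem_coe.2 (Finset.mem_image_of_mem f (Finset.mem_filter.2 ⟨hb, hnb⟩))
    calc Metric.infEDist x _ ≤ edist x (f b) := Metric.infEDist_le_edist_of_mem hmem
      _ ≤ edist x b + edist (f b) b := edist_triangle_right _ _ _
      _ ≤ kCenterOpt k P + kCenterOpt k P := add_le_add hxb (hf b hnb).2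
      _ = _ := (two_mul _).symm

theorem IsApproxAlgorithm.isApproxSolution_of_cover [Fintype V] [Nonempty V] {k : ℕ} (hk : 1 ≤ k)
    {α : ℝ} (hα : 0 ≤ α) {A : Finset V → Finset V} (hA : IsApproxAlgorithm k α A) {C : Finset V}
    (hC : ∀ x, Metric.infEDist x (C : Set V) ≤ 2 * kCenterOpt k (Finset.univ : Finset V)) :
    IsApproxSolution k (4 * α + 2) Finset.univ (A C) := by
  obtain ⟨-, h2, h3⟩ := hA C
  refine ⟨Finset.subset_univ _, h2, coveringRadius_le_iff.2 fun x _ => ?_⟩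
  have hCne : C.Nonempty := by
    rw [Finset.nonempty_iff_ne_empty]
    rintro rfl
    have h := (exists_kCenter_optimal (Finset.univ_nonempty (α := V)) hk).1
    have := (hC x).trans_lt (ENNReal.mul_lt_top ENNReal.ofNat_lt_top h.lt_top)
    simp at this
  obtain ⟨c, hc, hxc⟩ := Finset.exists_edist_eq_infEDist hCne x
  calc Metric.infEDist x (A C : Set V)
      ≤ Metric.infEDist c (A C : Set V) + edist x c := Metric.infEDist_le_infEDist_add_edist
    _ ≤ ENNReal.ofReal α * (2 * kCenterOpt k Finset.univ) + 2 * kCenterOpt k Finset.univ := by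
        refine add_le_add (((infEDist_le_coveringRadius hc).trans h3).trans ?_) (hxc ▸ hC x)
        gcongr
        exact kCenterOpt_le_two_mul (Finset.subset_univ _) Finset.univ_nonempty hk
    -- The argument yields the factor `2 * α + 2`; the next step weakens it.
    _ = ENNReal.ofReal (2 * α + 2) * kCenterOpt k Finset.univ := by
        rw [ENNReal.ofReal_add (by positivity) (by positivity), ENNReal.ofReal_mul (by norm_num)]
        simp only [ENNReal.ofReal_ofNat]
        ring
    _ ≤ _ := by
        gcongr
        norm_num

/-! ### Pivots and the points they remove -/

open Classical in
theorem exists_isPivot {t : ℕ} (ht : 0 < t) {H S : Finset V} (hH : t ≤ H.card) :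
    ∃ v, IsPivot t H S v := by
  let d : V → ℝ≥0∞ := fun x => Metric.infEDist x (S : Set V)
  have hHne : H.Nonempty := Finset.card_pos.1 (ht.trans_le hH)
  have hne : (H.filter fun v => t ≤ (H.filter fun h => d v ≤ d h).card).Nonempty := by
    obtain ⟨v, hv, hmin⟩ := Finset.exists_min_image H d hHne
    refine ⟨v, Finset.mem_filter.2 ⟨hv, ?_⟩⟩
    rwa [Finset.filter_true_of_mem hmin]
  -- Take the farthest `v` with at least `t` points of `H` at its distance or beyond. If `t` points
  -- were strictly farther, the nearest of them would also qualify.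
  obtain ⟨v, hv, hmax⟩ := Finset.exists_max_image _ d hne
  rw [Finset.mem_filter] at hv
  refine ⟨v, hv.1, ?_, hv.2⟩
  by_contra! hcon
  obtain ⟨w, hw, hmin⟩ := Finset.exists_min_image (H.filter fun h => d v < d h) d
    (Finset.card_pos.1 (ht.trans_le hcon))
  rw [Finset.mem_filter] at hw
  refine (hmax w (Finset.mem_filter.2 ⟨hw.1, hcon.trans (Finset.card_le_card ?_)⟩)).not_gt hw.2
  intro h hh
  exact Finset.mem_filter.2 ⟨(Finset.mem_filter.1 hh).1, hmin h hh⟩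

open Classical in
-- A survivor outside `W` would be farther than the pivot, and then so would all points of `H ∩ W`:
-- at least `t` points, too many ahead of the pivot.
theorem survivors_subset_of_card_inter {t : ℕ} (ht : 0 < t) {H S R W : Finset V}
    (hW : ∀ x ∈ R, x ∉ W → ∀ w ∈ W,
      Metric.infEDist x (S : Set V) ≤ Metric.infEDist w (S : Set V))
    (hHW : t ≤ (H ∩ W).card) : survivors t H S R ⊆ W := by
  obtain ⟨v, hv⟩ := exists_isPivot (S := S) ht
    (hHW.trans (Finset.card_le_card Finset.inter_subset_left))
  intro x hx
  obtain ⟨hxR, -, hx⟩ := Finset.mem_filter.1 hx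
  by_contra hxW
  have hxv := not_le.1 (hx v hv)
  refine (hHW.trans (Finset.card_le_card ?_)).not_gt hv.2.1
  intro h hh
  obtain ⟨hh, hhW⟩ := Finset.mem_inter.1 hh
  exact Finset.mem_filter.2 ⟨hh, hxv.trans_le (hW x hxR hxW h hhW)⟩

open Classical in
-- If a point beyond `ρ` is removed, the pivot is beyond `ρ` too, and with it at least `t` points of
-- `H`.
theorem infEDist_le_of_not_mem_survivors {t : ℕ} {H S R : Finset V} {ρ : ℝ≥0∞} (hHR : H ⊆ R)
    (hH : (H ∩ R.filter fun x => ρ < Metric.infEDist x (S : Set V)).card < t) {x : V}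
    (hx : x ∈ R) (hxs : x ∉ survivors t H S R) : Metric.infEDist x (S : Set V) ≤ ρ := by
  by_contra! hlt
  refine hxs (Finset.mem_filter.2 ⟨hx, fun hxS => ?_, fun v hv hxv => ?_⟩)
  · rw [Metric.infEDist_zero_of_mem (Finset.mem_coe.2 hxS)] at hlt
    exact not_lt_zero hlt
  · refine (hv.2.2.trans (Finset.card_le_card ?_)).not_gt hH
    intro h hh
    obtain ⟨hhH, hvh⟩ := Finset.mem_filter.1 hh
    exact Finset.mem_inter.2 ⟨hhH, Finset.mem_filter.2
      ⟨hHR hhH, hlt.trans_le (hxv.trans hvh)⟩⟩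

end Covering

theorem Finset.exists_top_subset {V β : Type*} [LinearOrder β] (R : Finset V) (d : V → β) (m : ℕ)
    (hm : m ≤ R.card) :
    ∃ W ⊆ R, W.card = m ∧ ∀ x ∈ R, x ∉ W → ∀ w ∈ W, d x ≤ d w := by
  classical
  induction m with
  | zero => exact ⟨∅, by simp⟩
  | succ m ih =>
    obtain ⟨W, hWR, hWm, hW⟩ := ih (by omega)
    have hne : (R \ W).Nonempty := by
      rw [← Finset.card_pos, Finset.card_sdiff_of_subset hWR]; omega
    obtain ⟨y, hy, hmax⟩ := Finset.exists_max_image _ d hne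
    rw [Finset.mem_sdiff] at hy
    refine ⟨insert y W, Finset.insert_subset hy.1 hWR, ?_, fun x hx hxW w hw => ?_⟩
    · rw [Finset.card_insert_of_notMem hy.2, hWm]
    · rw [Finset.mem_insert, not_or] at hxW
      rcases Finset.mem_insert.1 hw with rfl | hw
      · exact hmax x (Finset.mem_sdiff.2 ⟨hx, hxW.2⟩)
      · exact hW x hx hxW.2 w hw

open Classical in
/-- A sample that meets all the large pieces of a cover of `R` by `k` balls of radius `ρ` leaves
few points of `R` at distance more than `2 * ρ`. -/
theorem card_far_le {V : Type*} [MetricSpace V] (R S B : Finset V) (ρ : ℝ≥0∞) (m : ℝ) (hm : 0 ≤ m)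
    (hcov : ∀ x ∈ R, ∃ c ∈ B, edist x c ≤ ρ)
    (hhit : ∀ c ∈ B, m ≤ (R.filter fun x => edist x c ≤ ρ).card →
      ¬ Disjoint S (R.filter fun x => edist x c ≤ ρ)) :
    ((R.filter fun x => 2 * ρ < Metric.infEDist x (S : Set V)).card : ℝ) ≤ B.card * m := by
  let D : V → Finset V := fun c => R.filter fun x => edist x c ≤ ρ
  let B' := B.filter fun c => ((D c).card : ℝ) < m
  have hsub : (R.filter fun x => 2 * ρ < Metric.infEDist x (S : Set V)) ⊆ B'.biUnion D := by
    intro x hx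
    obtain ⟨hxR, hx⟩ := Finset.mem_filter.1 hx
    obtain ⟨c, hc, hxc⟩ := hcov x hxR
    refine Finset.mem_biUnion.2 ⟨c, Finset.mem_filter.2 ⟨hc, ?_⟩, Finset.mem_filter.2 ⟨hxR, hxc⟩⟩
    by_contra! hcm
    obtain ⟨s, hs, hsD⟩ := Finset.not_disjoint_iff.1 (hhit c hc hcm)
    refine hx.not_ge ?_
    calc Metric.infEDist x (S : Set V) ≤ edist x s :=
          Metric.infEDist_le_edist_of_mem (Finset.mem_coe.2 hs)
      _ ≤ edist x c + edist s c := edist_triangle_right _ _ _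
      _ ≤ ρ + ρ := add_le_add hxc (Finset.mem_filter.1 hsD).2
      _ = 2 * ρ := (two_mul _).symm
  calc ((R.filter fun x => 2 * ρ < Metric.infEDist x (S : Set V)).card : ℝ)
      ≤ ((B'.biUnion D).card : ℝ) := by exact_mod_cast Finset.card_le_card hsub
    _ ≤ ∑ c ∈ B', ((D c).card : ℝ) := by exact_mod_cast Finset.card_biUnion_le
    _ ≤ B'.card * m := by
        rw [← nsmul_eq_mul]
        exact Finset.sum_le_card_nsmul _ _ _ fun c hc => (Finset.mem_filter.1 hc).2.le
    _ ≤ B.card * m := by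
        gcongr
        exact Finset.filter_subset _ _

/-! ## The loop -/

section Loop

variable {V : Type*} [MetricSpace V]

/-- Every point is still in play or within distance `2 * ρ` of the sample. -/
def IsCovered (ρ : ℝ≥0∞) (s : Finset V × Finset V) : Prop :=
  ∀ x, x ∈ s.2 ∨ Metric.infEDist x (s.1 : Set V) ≤ 2 * ρ

open Classical in
theorem isCovered_step {ρ : ℝ≥0∞} {S R T H : Finset V} {t : ℕ} (h : IsCovered ρ (S, R))
    (hHR : H ⊆ R)
    (hH : (H ∩ R.filter fun x => 2 * ρ < Metric.infEDist x ((S ∪ T : Finset V) : Set V)).card < t) :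
    IsCovered ρ (S ∪ T, survivors t H (S ∪ T) R) := by
  intro x
  rw [or_iff_not_imp_left]
  intro hx
  rcases h x with hxR | hxS
  · exact infEDist_le_of_not_mem_survivors hHR hH hxR hx
  · refine (Metric.infEDist_anti ?_).trans hxS
    exact Finset.coe_subset.2 Finset.subset_union_left

variable [Fintype V]

open Classical in
-- The first term is a union bound over the pieces that `T` may miss; the second collects the two
-- tail events for `H`.
theorem eimStep_failure_le {k : ℕ} (hk : 1 ≤ k) {ε φ x M : ℝ} (hε : 0 < ε) (hx : 1 ≤ x)
    (hφ : 2.53 * x ≤ φ) (hL : 1 ≤ Real.log (Fintype.card V))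
    (hq : (Fintype.card V : ℝ) ^ ε = M ^ 4) (hM : 2 ≤ M) (hMφ : φ ≤ M) (hMεφ : ε * φ ≤ M)
    (hMε : ε ≤ M) {ρ : ℝ≥0∞} {B : Finset V} (hBk : B.card ≤ k)
    (hB : ∀ x, ∃ c ∈ B, edist x c ≤ ρ) {S R : Finset V} (hR : LoopActive V k ε R)
    (hSR : IsCovered ρ (S, R)) :
    (eimStep k ε φ (S, R)).toOuterMeasure
        {s | ¬ (IsCovered ρ s ∧ (s.2.card : ℝ) * M ≤ R.card)}
      ≤ k * ENNReal.ofReal (Real.exp (-(x + 1) * Real.log (Fintype.card V)))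
        + 2 * ENNReal.ofReal (Real.exp (-x * Real.log (Fintype.card V))) := by
  have hR' := hR
  rw [LoopActive, hq] at hR'
  rw [eimStep, if_pos hR]
  simp only [hq]
  set L := Real.log (Fintype.card V)
  have hk' : (1 : ℝ) ≤ k := by exact_mod_cast hk
  have hM2 : M ≤ M ^ 2 := by nlinarith
  have hscale : 4 / ε * M ^ 4 * L ≤ R.card := by
    refine le_trans ?_ hR'.le
    have : 0 ≤ 4 / ε * M ^ 4 * L := by positivity
    nlinarith
  have hR0 : (0 : ℝ) < R.card := lt_of_lt_of_le (by positivity) hscale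
  have hRM : 4 / ε * M ^ 2 * L ≤ R.card / M ^ 2 := by
    rw [le_div_iff₀ (by positivity)]
    linarith
  have hφ0 : 0 < φ := by linarith
  let D : V → Finset V := fun c => R.filter fun x => edist x c ≤ ρ
  -- Chosen so that `T` has mean at least `(x + 1) * L` on a piece of size `m`, and so misses it
  -- with probability at most `n ^ (-(x + 1))`.
  let m : ℝ := (x + 1) * R.card / (9 * k * M ^ 4)
  have hm0 : 0 ≤ m := by positivity
  let A : Set (Finset V) := ⋃ c ∈ B.filter fun c => m ≤ (D c).card, {T | Disjoint T (D c)}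
  refine (PMF.toOuterMeasure_bind_le _ _ A _
    (2 * ENNReal.ofReal (Real.exp (-x * L))) fun T hT => ?_).trans (add_le_add_left ?_ _)
  · have hfar := card_far_le R (S ∪ T) B ρ m hm0 (fun x _ => hB x) fun c hc hmc hdis => hT <| by
      simp only [A, Set.mem_iUnion]
      exact ⟨c, Finset.mem_filter.2 ⟨hc, hmc⟩, (Finset.disjoint_union_left.1 hdis).2⟩
    set U := R.filter fun x => 2 * ρ < Metric.infEDist x ((S ∪ T : Finset V) : Set V)
    have hU : 4 * M ^ 4 * L / R.card * U.card ≤ 4 * (x + 1) * L / 9 := by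
      calc 4 * M ^ 4 * L / R.card * U.card ≤ 4 * M ^ 4 * L / R.card * (k * m) := by
            gcongr
            exact hfar.trans (by gcongr)
        _ = 4 * (x + 1) * L / 9 := by
            simp only [m]
            field_simp
    have hone : 1 ≤ (R.card : ℝ) / M ^ 2 := by
      refine le_trans ?_ hRM
      rw [div_mul_eq_mul_div, div_mul_eq_mul_div, le_div_iff₀ hε]
      nlinarith
    have hcard : ⌈(R.card : ℝ) / M ^ 2⌉₊ ≤ R.card := by
      refine Nat.ceil_le.2 (div_le_self hR0.le ?_)
      nlinarith
    -- The mean of `|H ∩ W|` before clipping is at least `4 * φ * L`. Rounding up at most doubles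
    -- `|W|`, which `2 ≤ M` absorbs.
    obtain ⟨W, hWR, hWm, hW⟩ := Finset.exists_top_subset R
      (fun x => Metric.infEDist x ((S ∪ T : Finset V) : Set V)) _ hcard
    have hWle : (R.card : ℝ) / M ^ 2 ≤ W.card := hWm ▸ Nat.le_ceil _
    have hWge : (W.card : ℝ) * M ≤ R.card := by
      have h1 : (W.card : ℝ) ≤ R.card / M ^ 2 * 2 := by
        have := Nat.ceil_lt_add_one (zero_le_one.trans hone)
        rw [← hWm] at this
        linarith
      calc (W.card : ℝ) * M ≤ R.card / M ^ 2 * 2 * M := by gcongr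
        _ = R.card * (2 / M) := by field_simp
        _ ≤ R.card * 1 := by
            gcongr
            exact (div_le_one (by linarith)).2 hM
        _ = R.card := mul_one _
    have htail₁ := randomSubset_upper_tail_le R U (Finset.filter_subset _ _)
      (4 * M ^ 4 * L / R.card) (φ * L) _ (by positivity) hU
    have htail₂ := randomSubset_lower_tail_le R W hWR (4 * M ^ 4 * L / R.card) (φ * L) (4 * φ * L)
      (by
        calc 4 * φ * L ≤ 4 * M ^ 2 * L := by gcongr; linarith
          _ = 4 * M ^ 4 * L / R.card * (R.card / M ^ 2) := by field_simp
          _ ≤ _ := by gcongr)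
      (by
        refine le_trans ?_ (hRM.trans hWle)
        refine mul_le_mul_of_nonneg_right ?_ (by linarith)
        rw [div_mul_eq_mul_div, le_div_iff₀ hε]
        linarith)
    refine (PMF.toOuterMeasure_bind_le _ _ _ _ 0 fun H hH => ?_).trans
      ((add_zero _).trans_le ((MeasureTheory.measure_union_le _ _).trans
        ((add_le_add htail₁ htail₂).trans ?_)))
    · rw [Set.mem_union, not_or] at hH
      obtain ⟨h1, h2⟩ := hH
      simp only [Set.mem_ofPred_eq, not_not, not_lt] at h1 h2
      rw [PMF.toOuterMeasure_pure_apply, if_neg]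
      rw [Set.mem_ofPred_eq, not_not]
      refine ⟨isCovered_step hSR h1.1 h1.2, le_trans ?_ hWge⟩
      gcongr
      exact survivors_subset_of_card_inter (Nat.ceil_pos.2 (by positivity)) hW h2
    · rw [two_mul]
      refine add_le_add ?_ ?_ <;> refine ENNReal.ofReal_le_ofReal (Real.exp_le_exp.2 ?_)
      -- As `x + 1 ≤ 2 * x`, this needs `1 + 1.72 * 8 / 9 < 2.53`, the source of the constant in
      -- `hφ`.
      · nlinarith
      · nlinarith
  · refine (MeasureTheory.measure_biUnion_finset_le _ _).trans ?_
    refine (Finset.sum_le_card_nsmul _ _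
      (ENNReal.ofReal (Real.exp (-(x + 1) * L))) fun c hc => ?_).trans ?_
    · rw [neg_mul]
      refine randomSubset_miss_le R (D c) (Finset.filter_subset _ _) _ _ (by positivity) ?_
      calc (x + 1) * L = 9 * k * M ^ 4 * L / R.card * m := by
            simp only [m]
            field_simp
        _ ≤ _ := by
            gcongr
            exact (Finset.mem_filter.1 hc).2
    · rw [nsmul_eq_mul]
      gcongr
      exact (Finset.card_filter_le _ _).trans hBk

/-- The size bound is conditional on the loop being active, since a stopped state no longer shrinks.
-/
theorem eimState_failure_le {k : ℕ} (hk : 1 ≤ k) {ε φ x M : ℝ} (hε : 0 < ε) (hx : 1 ≤ x)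
    (hφ : 2.53 * x ≤ φ) (hL : 1 ≤ Real.log (Fintype.card V))
    (hq : (Fintype.card V : ℝ) ^ ε = M ^ 4) (hM : 2 ≤ M) (hMφ : φ ≤ M) (hMεφ : ε * φ ≤ M)
    (hMε : ε ≤ M) {ρ : ℝ≥0∞} {B : Finset V} (hBk : B.card ≤ k)
    (hB : ∀ x, ∃ c ∈ B, edist x c ≤ ρ) (N : ℕ) :
    (eimState (V := V) k ε φ N).toOuterMeasure
        {s | ¬ (IsCovered ρ s ∧ (LoopActive V k ε s.2 → (s.2.card : ℝ) * M ^ N ≤ Fintype.card V))}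
      ≤ N * (3 * ENNReal.ofReal (Real.exp (-x * Real.log (Fintype.card V)))) := by
  induction N with
  | zero =>
    rw [eimState, PMF.toOuterMeasure_pure_apply, if_neg]
    · exact zero_le
    · rw [Set.mem_ofPred_eq, not_not]
      exact ⟨fun x => Or.inl (Finset.mem_univ x), fun _ => by simp⟩
  | succ N ih =>
    rw [Nat.cast_succ, add_mul, one_mul, eimState]
    refine (PMF.toOuterMeasure_bind_le _ _ _ _ _ fun s hs => ?_).trans (add_le_add_left ih _)
    rw [Set.mem_ofPred_eq, not_not] at hs
    by_cases hact : LoopActive V k ε s.2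
    · have hstep := eimStep_failure_le (S := s.1) hk hε hx hφ hL hq hM hMφ hMεφ hMε hBk hB hact hs.1
      refine (MeasureTheory.measure_mono ?_).trans (hstep.trans ?_)
      · intro s' hs' hgood
        refine hs' ⟨hgood.1, fun _ => ?_⟩
        calc (s'.2.card : ℝ) * M ^ (N + 1) = s'.2.card * M * M ^ N := by ring
          _ ≤ s.2.card * M ^ N := by gcongr; exact hgood.2
          _ ≤ _ := hs.2 hact
      -- An active loop forces `k ≤ n`, which turns `k * n ^ (-(x + 1))` into at most `n ^ (-x)`.
      · have hkn : (k : ℝ) ≤ Fintype.card V := by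
          rw [LoopActive, hq] at hact
          have h1 : (s.2.card : ℝ) ≤ Fintype.card V := by exact_mod_cast Finset.card_le_univ _
          refine le_trans ?_ (hact.le.trans h1)
          have h2 : 1 ≤ 4 / ε * M ^ 4 * Real.log (Fintype.card V) := by
            rw [div_mul_eq_mul_div, div_mul_eq_mul_div, le_div_iff₀ hε]
            have : M ≤ M ^ 4 := le_self_pow₀ (by linarith) (by norm_num)
            nlinarith
          have h3 : (0 : ℝ) ≤ k := Nat.cast_nonneg _
          nlinarith
        rw [show (3 : ℝ≥0∞) = 1 + 2 by norm_num, add_mul, one_mul]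
        gcongr
        rw [← ENNReal.ofReal_natCast, ← ENNReal.ofReal_mul (Nat.cast_nonneg _)]
        refine ENNReal.ofReal_le_ofReal ?_
        have hn : (0 : ℝ) < Fintype.card V := by
          refine lt_of_lt_of_le ?_ hkn
          exact_mod_cast hk
        calc (k : ℝ) * Real.exp (-(x + 1) * Real.log (Fintype.card V))
            ≤ Real.exp (Real.log (Fintype.card V))
                * Real.exp (-(x + 1) * Real.log (Fintype.card V)) := by
              rw [Real.exp_log hn]; gcongr
          _ = _ := by rw [← Real.exp_add]; congr 1; ring
    · rw [eimStep, if_neg hact, PMF.toOuterMeasure_pure_apply, if_neg]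
      · exact zero_le
      · rw [Set.mem_ofPred_eq, not_not]
        exact ⟨hs.1, fun h => absurd h hact⟩

theorem eimSampleProb_ge {k : ℕ} (hk : 1 ≤ k) {ε φ x M : ℝ} (hε : 0 < ε) (hx : 1 ≤ x)
    (hφ : 2.53 * x ≤ φ) (hL : 1 ≤ Real.log (Fintype.card V))
    (hq : (Fintype.card V : ℝ) ^ ε = M ^ 4) (hM : 2 ≤ M) (hMφ : φ ≤ M) (hMεφ : ε * φ ≤ M)
    (hMε : ε ≤ M) {ρ : ℝ≥0∞} {B : Finset V} (hBk : B.card ≤ k)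
    (hB : ∀ x, ∃ c ∈ B, edist x c ≤ ρ) {N : ℕ} (hN : (Fintype.card V : ℝ) ≤ M ^ N)
    {E : Set (Finset V)}
    (hE : ∀ C : Finset V, (∀ x, Metric.infEDist x (C : Set V) ≤ 2 * ρ) → C ∈ E) :
    1 - N * (3 * ENNReal.ofReal (Real.exp (-x * Real.log (Fintype.card V))))
      ≤ eimSampleProb k ε φ E := by
  classical
  refine le_trans ?_ (le_iSup _ N)
  refine le_trans (tsub_le_tsub_left ((MeasureTheory.measure_mono ?_).trans
    (eimState_failure_le hk hε hx hφ hL hq hM hMφ hMεφ hMε hBk hB N)) 1)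
    (PMF.one_sub_le_toOuterMeasure _ _)
  rw [Set.compl_subset_comm]
  intro s hs
  simp only [Set.mem_compl_iff, Set.mem_ofPred_eq, not_not] at hs
  obtain ⟨hcov, hsmall⟩ := hs
  refine ⟨fun hact => ?_, hE _ fun x => ?_⟩
  -- An active loop would need `|R| > 1`, but `|R| * M ^ N ≤ n ≤ M ^ N`.
  · have h := hsmall hact
    rw [LoopActive, hq] at hact
    have hk' : (1 : ℝ) ≤ k := by exact_mod_cast hk
    have h2 : 1 ≤ 4 / ε * M ^ 4 * Real.log (Fintype.card V) := by
      rw [div_mul_eq_mul_div, div_mul_eq_mul_div, le_div_iff₀ hε]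
      have : M ≤ M ^ 4 := le_self_pow₀ (by linarith) (by norm_num)
      nlinarith
    have h3 : 1 < (s.2.card : ℝ) := by
      refine lt_of_le_of_lt ?_ hact
      nlinarith
    have h4 : 0 < M ^ N := by positivity
    nlinarith
  · rw [Finset.coe_union]
    rcases hcov x with h | h
    · rw [Metric.infEDist_zero_of_mem (Set.mem_union_right _ (Finset.mem_coe.2 h))]
      exact zero_le
    · exact (Metric.infEDist_anti Set.subset_union_left).trans h

end Loop

/-- The condition on `φ`, `x` and `b` forces `φ` to be large compared to `x`. -/
theorem le_of_pivot_condition {φ x b : ℝ} (hφ : 0 < φ) (hx : 0 < x) (hb : 0 < b) (hb5 : b ≤ 5)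
    (h : (φ + x + √(2 * x * φ + x ^ 2)) / b ≤ φ + x / 2 - √(2 * x * φ + x ^ 2 / 4)) :
    2.53 * x ≤ φ := by
  have h1 : x ≤ √(2 * x * φ + x ^ 2) := Real.le_sqrt_of_sq_le (by nlinarith [mul_pos hx hφ])
  have h2 : (φ + 2 * x) / 5 ≤ φ + x / 2 - √(2 * x * φ + x ^ 2 / 4) := by
    refine le_trans (div_le_div₀ ?_ ?_ hb hb5) h
    · positivity
    · linarith
  have h3 : √(2 * x * φ + x ^ 2 / 4) ^ 2 = 2 * x * φ + x ^ 2 / 4 := Real.sq_sqrt (by positivity)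
  have h4 := Real.sqrt_nonneg (2 * x * φ + x ^ 2 / 4)
  have h5 : √(2 * x * φ + x ^ 2 / 4) ≤ 4 / 5 * φ + x / 10 := by linarith
  have h6 : 2 * x * φ + x ^ 2 / 4 ≤ (4 / 5 * φ + x / 10) ^ 2 := by
    rw [← h3]; gcongr
  -- `h6` amounts to `(φ - 3 * x) * (0.64 * φ + 0.08 * x) ≥ 0`, so even `3 * x ≤ φ` holds; `2.53` is
  -- what the tail bound consumes.
  by_contra! hlt
  nlinarith [mul_pos hx hφ]

/-! ### Large `n`, choice of `K`, and conclusion -/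

theorem exists_card_large (ε φ : ℝ) (hε : 0 < ε) :
    ∃ n₀ : ℕ, ∀ n ≥ n₀, 1 ≤ Real.log n ∧ 2 ≤ (n : ℝ) ^ (ε / 4) ∧ φ ≤ (n : ℝ) ^ (ε / 4) ∧
      ε * φ ≤ (n : ℝ) ^ (ε / 4) ∧ ε ≤ (n : ℝ) ^ (ε / 4) := by
  have hlog := Real.tendsto_log_atTop.comp (tendsto_natCast_atTop_atTop (R := ℝ))
  have hpow := (tendsto_rpow_atTop (y := ε / 4) (by positivity)).comp
    (tendsto_natCast_atTop_atTop (R := ℝ))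
  exact Filter.eventually_atTop.1 ((hlog.eventually_ge_atTop 1).and
    ((hpow.eventually_ge_atTop 2).and ((hpow.eventually_ge_atTop φ).and
      ((hpow.eventually_ge_atTop (ε * φ)).and (hpow.eventually_ge_atTop ε)))))

theorem exists_eimSampleProb_bound (ε φ : ℝ) (hε : 0 < ε) (hφ : 0 < φ) :
    ∃ K : ℝ, ∀ x : ℝ, 1 ≤ x → 2.53 * x ≤ φ →
      ∀ (V : Type*) [MetricSpace V] [Fintype V] [Nonempty V] (k : ℕ), 1 ≤ k →
        ∀ E : Set (Finset V),
          (∀ C : Finset V, (∀ x, Metric.infEDist x (C : Set V)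
            ≤ 2 * kCenterOpt k (Finset.univ : Finset V)) → C ∈ E) →
          ENNReal.ofReal (1 - K * (Fintype.card V : ℝ) ^ (-x)) ≤ eimSampleProb k ε φ E := by
  obtain ⟨n₀, hn₀⟩ := exists_card_large ε φ hε
  let N : ℕ := ⌈4 / ε⌉₊
  -- For `n < n₀` the second entry makes the claim void: `x ≤ φ` gives `n ^ x ≤ n₀ ^ φ`, uniformly
  -- in `x`.
  refine ⟨max (N * 3) ((n₀ : ℝ) ^ φ), fun x hx hφx V _ _ _ k hk E hE => ?_⟩
  have hn1 : (1 : ℝ) ≤ Fintype.card V := by exact_mod_cast Fintype.card_pos (α := V)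
  have hn : (0 : ℝ) < Fintype.card V := by linarith
  have hpos : 0 < (Fintype.card V : ℝ) ^ (-x) := Real.rpow_pos_of_pos hn _
  rcases lt_or_ge (Fintype.card V) n₀ with hlt | hge
  · rw [ENNReal.ofReal_of_nonpos]
    · exact zero_le
    · have h1 : (Fintype.card V : ℝ) ^ x ≤ (n₀ : ℝ) ^ φ :=
        calc (Fintype.card V : ℝ) ^ x ≤ (Fintype.card V : ℝ) ^ φ :=
              Real.rpow_le_rpow_of_exponent_le hn1 (by linarith)
          _ ≤ (n₀ : ℝ) ^ φ := by gcongr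
      have h2 := h1.trans (le_max_right ((N : ℝ) * 3) _)
      have h3 : (Fintype.card V : ℝ) ^ x * (Fintype.card V : ℝ) ^ (-x) = 1 := by
        rw [← Real.rpow_add hn, add_neg_cancel, Real.rpow_zero]
      have h4 := mul_le_mul_of_nonneg_right h2 hpos.le
      linarith
  · obtain ⟨hL, hM, hMφ, hMεφ, hMε⟩ := hn₀ _ hge
    obtain ⟨-, B, -, hBk, hB⟩ := exists_kCenter_optimal (Finset.univ_nonempty (α := V)) hk
    have hq : (Fintype.card V : ℝ) ^ ε = ((Fintype.card V : ℝ) ^ (ε / 4)) ^ 4 := by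
      rw [← Real.rpow_mul_natCast hn.le]; congr 1; push_cast; ring
    have hN : (Fintype.card V : ℝ) ≤ ((Fintype.card V : ℝ) ^ (ε / 4)) ^ N := by
      rw [← Real.rpow_mul_natCast hn.le]
      refine Real.self_le_rpow_of_one_le hn1 ?_
      have := Nat.le_ceil (4 / ε)
      rw [div_le_iff₀ hε] at this
      linarith
    refine le_trans ?_ (eimSampleProb_ge hk hε hx hφx hL hq hM hMφ hMεφ hMε hBk
      (fun x => hB x (Finset.mem_univ x)) hN hE)
    have hexp : Real.exp (-x * Real.log (Fintype.card V)) = (Fintype.card V : ℝ) ^ (-x) := by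
      rw [Real.rpow_def_of_pos hn, mul_comm]
    rw [hexp, ENNReal.ofReal_sub _ (by positivity), ENNReal.ofReal_one]
    refine tsub_le_tsub_left ?_ 1
    rw [← ENNReal.ofReal_natCast, ← ENNReal.ofReal_ofNat, ← ENNReal.ofReal_mul (by norm_num),
      ← ENNReal.ofReal_mul (Nat.cast_nonneg _), ← mul_assoc]
    refine ENNReal.ofReal_le_ofReal ?_
    gcongr
    exact le_max_left _ _

theorem mainTheorem3 (ε φ : ℝ) (hε : 0 < ε) (hφ : 0 < φ) :
    ∃ K : ℝ, ∀ (γ b : ℝ), 0 < γ → 0 < b → b ≤ 5 →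
      (φ + (1 + γ) + √(2 * (1 + γ) * φ + (1 + γ) ^ 2)) / b
        ≤ φ + (1 + γ) / 2 - √(2 * (1 + γ) * φ + (1 + γ) ^ 2 / 4) →
      ∀ (V : Type*) [MetricSpace V] [Fintype V] [Nonempty V] (k : ℕ), 1 ≤ k →
        (∀ (α : ℝ) (A : Finset V → Finset V), 1 ≤ α → IsApproxAlgorithm k α A →
          ENNReal.ofReal (1 - K * (Fintype.card V : ℝ) ^ (-(1 + γ)))
            ≤ eimSampleProb k ε φ
                {C | IsApproxSolution k (4 * α + 2) Finset.univ (A C)}) ∧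
        (∀ A : Finset V → Finset V, IsApproxAlgorithm k 2 A →
          ENNReal.ofReal (1 - K * (Fintype.card V : ℝ) ^ (-(1 + γ)))
            ≤ eimSampleProb k ε φ
                {C | IsApproxSolution k 10 Finset.univ (A C)}) := by
  obtain ⟨K, hK⟩ := exists_eimSampleProb_bound ε φ hε hφ
  refine ⟨K, fun γ b hγ hb hb5 h V _ _ _ k hk => ?_⟩
  have hφγ := le_of_pivot_condition hφ (by linarith) hb hb5 h
  have main : ∀ (α : ℝ) (A : Finset V → Finset V), 1 ≤ α → IsApproxAlgorithm k α A →
      ENNReal.ofReal (1 - K * (Fintype.card V : ℝ) ^ (-(1 + γ)))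
        ≤ eimSampleProb k ε φ {C | IsApproxSolution k (4 * α + 2) Finset.univ (A C)} :=
    fun α A hα hA => hK (1 + γ) (by linarith) hφγ V k hk _ fun C hC =>
      hA.isApproxSolution_of_cover hk (by linarith) hC
  refine ⟨main, fun A hA => ?_⟩
  have h2 := main 2 A one_le_two hA
  norm_num at h2 ⊢
  exact h2
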